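/- For $p\ge 1$ let $${}_{p+1}F_p\left[{a_1,\ldots,a_{p+1};\atop b_1,\ldots,b_p;}\,z\right]=\sum_{n=0}^\infty\frac{(a_1)_n\cdots(a_{p+1})_n}{n!\,(b_1)_n\cdots(b_p)_n}\,z^n,\qquad (x)_n=x(x+1)\cdots(x+n-1),\ (x)_0=1,$$ and for complex numbers $a,b,c,d,e,f,g$ put $$L(a,b,c,d;e;f,g)=\frac{{}_4F_3\left[{a,b,c,d;\atop e,f,g;}\,1\right]}{\sin(\pi e)\,\Gamma(e)\Gamma(f)\Gamma(g)\Gamma(1+a-e)\Gamma(1+b-e)\Gamma(1+c-e)\Gamma(1+d-e)}$$ $$-\frac{{}_4F_3\left[{1+a-e,\,1+b-e,\,1+c-e,\,1+d-e;\atop 1+f-e,\,1+g-e,\,2-e;}\,1\right]}{\sin(\pi e)\,\Gamma(a)\Gamma(b)\Gamma(c)\Gamma(d)\Gamma(1+f-e)\Gamma(1+g-e)\Gamma(2-e)},$$ where $1/\Gamma$ is the entire reciprocal Gamma function (zero at $0,-1,-2,\ldots$). Call $(e;f,g)$ admissible if $\sin(\pi e)\neq 0$ and none of the denominator parameters $e,\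 f,\ g,\ 1+f-e,\ 1+g-e,\ 2-e$ belongs to $\{0,-1,-2,\ldots\}$. Let $a,b,c,d,e,f,g\in\mathbb C$ satisfy $e+f+g-a-b-c-d=1$, and suppose that both $(e;f,g)$ and $(1+a+b-f;\,1+a+b-e,\,g)$ are admissible. Then the ${}_4F_3(1)$ series occurring in $L(a,b,c,d;e;f,g)$ and in $L(a,b,g-c,g-d;1+a+b-f;1+a+b-e,g)$ converge absolutely, and $$L(a,b,c,d;e;f,g)=L(a,b,g-c,g-d;\,1+a+b-f;\,1+a+b-e,\,g).$$ -/

import Mathlib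

open scoped Nat

noncomputable section

/-- The `n`-th term `(a₁)ₙ ⋯ (a_{p+1})ₙ / (n! (b₁)ₙ ⋯ (b_p)ₙ) * zⁿ` of the hypergeometric series
`_{p+1}F_p[a₁, …, a_{p+1}; b₁, …, b_p; z]`. Here `(ascPochhammer ℂ n).eval x` is the rising
factorial `(x)ₙ = x (x + 1) ⋯ (x + n - 1)`. -/
def hypergeometricTerm {p : ℕ} (a : Fin (p + 1) → ℂ) (b : Fin p → ℂ) (z : ℂ) (n : ℕ) : ℂ :=
  (∏ i, (ascPochhammer ℂ n).eval (a i)) /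
    ((n ! : ℂ) * ∏ j, (ascPochhammer ℂ n).eval (b j)) * z ^ n

/-- The sum of the hypergeometric series `_{p+1}F_p[a₁, …, a_{p+1}; b₁, …, b_p; z]`. -/
def hypergeometricSum {p : ℕ} (a : Fin (p + 1) → ℂ) (b : Fin p → ℂ) (z : ℂ) : ℂ :=
  ∑' n : ℕ, hypergeometricTerm a b z n

/-- The function `L(a,b,c,d;e;f,g)`. The value `0` of `Complex.Gamma` at `0, -1, -2, …` together
with `x / 0 = 0` gives the reciprocal Gamma function its correct value `0` there. -/
def hypL (a b c d e f g : ℂ) : ℂ :=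
  hypergeometricSum ![a, b, c, d] ![e, f, g] 1 /
      (Complex.sin (Real.pi * e) * Complex.Gamma e * Complex.Gamma f * Complex.Gamma g *
        Complex.Gamma (1 + a - e) * Complex.Gamma (1 + b - e) *
        Complex.Gamma (1 + c - e) * Complex.Gamma (1 + d - e)) -
    hypergeometricSum ![1 + a - e, 1 + b - e, 1 + c - e, 1 + d - e]
        ![1 + f - e, 1 + g - e, 2 - e] 1 /
      (Complex.sin (Real.pi * e) * Complex.Gamma a * Complex.Gamma b * Complex.Gamma c *
        Complex.Gamma d * Complex.Gamma (1 + f - e) * Complex.Gamma (1 + g - e) *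
        Complex.Gamma (2 - e))

/-- The expression defining `L(a,b,c,d;e;f,g)` makes sense: `sin (π e)` does not vanish and
no denominator parameter of the two `₄F₃(1)` series is zero or a negative integer. -/
structure HypLAdmissible (e f g : ℂ) : Prop where
  sin_ne : Complex.sin (Real.pi * e) ≠ 0
  fst : ∀ n : ℕ, e ≠ -n ∧ f ≠ -n ∧ g ≠ -n
  snd : ∀ n : ℕ, 1 + f - e ≠ -n ∧ 1 + g - e ≠ -n ∧ 2 - e ≠ -n

/-- Both `₄F₃(1)` series in the definition of `L(a,b,c,d;e;f,g)` converge absolutely. -/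
def HypLConverges (a b c d e f g : ℂ) : Prop :=
  (Summable fun n => ‖hypergeometricTerm ![a, b, c, d] ![e, f, g] 1 n‖) ∧
  (Summable fun n => ‖hypergeometricTerm ![1 + a - e, 1 + b - e, 1 + c - e, 1 + d - e]
    ![1 + f - e, 1 + g - e, 2 - e] 1 n‖)

end

/-! Put `e' = 1 + a + b - f`; the balance condition makes this `e + g - c - d`. The two series in
`L` are the two ends of one terminating very-well-poised sum, `twoSidedSum`: its `j`-th term is `e -
1 - n + 2 * j` times the `j`-th coefficient of the first series and the `(n - j)`-th of the second.
Balance makes both families of coefficients O(n^(-2)). The weight is close to `-n` at one end and to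
`n` at the other, so `n` times the sum tends to a difference of the two series, each multiplied by
the leading Gamma quotient of the other. By the reflection formula this is `L` up to explicit Gamma
factors (`tendsto_twoSidedSum`).

It remains to transform the finite sums (`twoSidedSum_transform`). Dougall's theorem writes the part
of the `j`-th term involving `c, d, g` as a sum over `i ≤ j` against a kernel depending only on `e,
e', n, j, i`. After the order of summation is exchanged, the sum over `j`, which involves only `a,
b, f` and the kernel, is again of Dougall type and produces the transformed term. The prefactors
tend to a quotient of Gamma values, which cancels against the Gamma factors of the two limits. -/

section

open Finset Filter Topology

/-! ### Rising factorials and Dougall's summation theorem -/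

section Algebra

variable {K : Type*} [Field K]

/-- The rising factorial `x (x + 1) ⋯ (x + n - 1)`. -/
def rising (x : K) (n : ℕ) : K := ∏ i ∈ range n, (x + i)

@[simp] lemma rising_zero (x : K) : rising x 0 = 1 := by simp [rising]

lemma rising_succ (x : K) (n : ℕ) : rising x (n + 1) = rising x n * (x + n) := by
  simp [rising, prod_range_succ]

lemma rising_add (x : K) (m n : ℕ) : rising x (m + n) = rising x m * rising (x + m) n := by
  simp [rising, prod_range_add, add_assoc]

lemma rising_succ' (x : K) (n : ℕ) : rising x (n + 1) = x * rising (x + 1) n := by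
  rw [add_comm, rising_add]; simp [rising_succ]

lemma rising_reflect (x : K) (n : ℕ) : rising (1 - x - n) n = (-1) ^ n * rising x n := by
  induction n generalizing x with
  | zero => simp
  | succ n ih =>
    rw [rising_succ', rising_succ x, show 1 - x - ((n + 1 : ℕ) : K) + 1 = 1 - x - n by
      push_cast; ring, ih]
    push_cast; ring

lemma rising_ne_zero {x : K} (hx : ∀ n : ℕ, x ≠ -n) (n : ℕ) : rising x n ≠ 0 := by
  refine prod_ne_zero_iff.2 fun i _ h => hx i (eq_neg_of_add_eq_zero_left h)

/-- The denominator-free form of `(x)ᵢ / (1 + a - x)ᵢ`, scaled by `(1 + a - x)_N`. -/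
def poisedFactor (a x : K) (N i : ℕ) : K := rising x i * rising (1 + a - x + i) (N - i)

/-- The very-well-poised weight in the denominator-free form of Dougall's sum. -/
def poisedWeight (a : K) (N i : ℕ) : K :=
  (-1) ^ i * (N.choose i : K) * (a + 2 * i) / rising (a + i) (N + 1)

/-- The terms of the very-well-poised `₇F₆` with base `a` and free parameters `b, c, d, e`. -/
def dougallTerm (a b c d e : K) (N i : ℕ) : K :=
  poisedWeight a N i * (poisedFactor a b N i * poisedFactor a c N i * poisedFactor a d N i *
    poisedFactor a e N i)

lemma poisedFactor_succ (a x : K) {N i : ℕ} (h : i ≤ N) :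
    poisedFactor a x (N + 1) i = poisedFactor a x N i * (1 + a - x + N) := by
  obtain ⟨r, rfl⟩ := Nat.exists_eq_add_of_le h
  simp only [poisedFactor, show i + r + 1 - i = r + 1 by omega, show i + r - i = r by omega,
    rising_succ]
  push_cast; ring

lemma poisedFactor_succ_succ (a x : K) (N i : ℕ) :
    poisedFactor a x (N + 1) (i + 1) = x * poisedFactor (a + 2) (x + 1) N i := by
  simp only [poisedFactor, rising_succ', Nat.add_sub_add_right]
  rw [show 1 + (a + 2) - (x + 1) + (i : K) = 1 + a - x + ((i + 1 : ℕ) : K) by push_cast; ring]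
  ring

/-- Keeping `i - (N + 1)` on the left avoids a division and makes the relation valid for every `i`:
at `i = N + 1` that factor vanishes together with `N.choose i`. -/
lemma poisedWeight_succ {a : K} (ha : ∀ n : ℕ, a ≠ -n) (N i : ℕ) :
    (i - (N + 1)) * (a + i + N + 1) * poisedWeight a (N + 1) i =
      -(N + 1) * poisedWeight a N i := by
  have hi : ∀ n : ℕ, a + i ≠ -n := fun n h => ha (i + n) (by push_cast; linear_combination h)
  have h1 := rising_ne_zero hi (N + 1)
  have h2 : a + i + ((N + 1 : ℕ) : K) ≠ 0 := fun h => hi (N + 1) (eq_neg_of_add_eq_zero_left h)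
  have hc : (i - (N + 1)) * ((N + 1).choose i : K) = -(N + 1) * (N.choose i : K) := by
    rcases le_or_gt i (N + 1) with h | h
    · have h5 := congrArg (Nat.cast (R := K)) (Nat.choose_mul_succ_eq N i)
      rw [Nat.cast_mul, Nat.cast_mul, Nat.cast_sub h] at h5
      push_cast at h5
      linear_combination h5
    · rw [Nat.choose_eq_zero_of_lt h, Nat.choose_eq_zero_of_lt (by omega)]; simp
  simp only [poisedWeight]
  rw [rising_succ _ (N + 1)]
  field_simp
  push_cast
  linear_combination (a + i + N + 1) * (a + 2 * i) * hc

lemma poisedWeight_succ_succ {a : K} (ha : ∀ n : ℕ, a ≠ -n) (N i : ℕ) :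
    ((i : K) + 1) * (a + i + 1) * poisedWeight a (N + 1) (i + 1) =
      -(N + 1) * poisedWeight (a + 2) N i := by
  have hi : ∀ n : ℕ, a + i + 1 ≠ -n := fun n h =>
    ha (i + 1 + n) (by push_cast; linear_combination h)
  have hi' : ∀ n : ℕ, a + i + 1 + 1 ≠ -n := fun n h =>
    ha (i + 1 + 1 + n) (by push_cast; linear_combination h)
  have h1 := rising_ne_zero hi' (N + 1)
  have h2 : a + i + 1 ≠ 0 := by simpa using hi 0
  have hc : ((i : K) + 1) * ((N + 1).choose (i + 1) : K) = (N + 1) * (N.choose i : K) := by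
    have h5 := congrArg (Nat.cast (R := K)) (Nat.add_one_mul_choose_eq N i)
    push_cast at h5
    linear_combination -h5
  simp only [poisedWeight]
  rw [show a + ((i + 1 : ℕ) : K) = a + i + 1 by push_cast; ring,
    show a + 2 + (i : K) = a + i + 1 + 1 by ring, rising_succ' _ (N + 1)]
  field_simp
  push_cast
  rw [pow_succ]
  linear_combination -(a + 2 * (i + 1)) * (-1) ^ i * hc

lemma dougallTerm_zero {a : K} (ha : ∀ n : ℕ, a ≠ -n) (b c d e : K) (N : ℕ) :
    (N + 1) * (a + N + 1) * dougallTerm a b c d e (N + 1) 0 =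
      (N + 1) * (a - e + 1) * ((1 + a - b + N) * (1 + a - c + N) * (1 + a - d + N)) *
        dougallTerm a b c d (e - 1) N 0 := by
  have hw := poisedWeight_succ ha N 0
  have he : poisedFactor a e (N + 1) 0 = (1 + a - e) * poisedFactor a (e - 1) N 0 := by
    simp only [poisedFactor, rising_zero, Nat.sub_zero, rising_succ']
    rw [show 1 + a - (e - 1) + ((0 : ℕ) : K) = 1 + a - e + ((0 : ℕ) : K) + 1 by ring]
    push_cast; ring
  rw [dougallTerm, dougallTerm, he, poisedFactor_succ a b (Nat.zero_le N),
    poisedFactor_succ a c (Nat.zero_le N), poisedFactor_succ a d (Nat.zero_le N)]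
  push_cast at hw
  linear_combination (-(1 + a - e) * ((1 + a - b + N) * (1 + a - c + N) * (1 + a - d + N)) *
    (poisedFactor a b N 0 * poisedFactor a c N 0 * poisedFactor a d N 0 *
      poisedFactor a (e - 1) N 0)) * hw

/-- Once common factors are removed, this is a linear relation between the quadratics `(e + i)(2 + a
- e + i)`, `(N - i)(a + N + i + 2)` and `(i + 1)(a + i + 1)` in `i`. All three are invariant under
`i ↦ -a - 2 - i`, so the relation is fixed by its values at `i = -1` and `i = N`. Balance plays no
role here. The case `i = N` is separate because the first term on the right is then zero. -/
lemma dougallTerm_succ {a : K} (ha : ∀ n : ℕ, a ≠ -n) (b c d e : K) {N i : ℕ} (hi : i ≤ N) :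
    (N + 1) * (a + N + 1) * dougallTerm a b c d e (N + 1) (i + 1) =
      (N + 1) * (a - e + 1) * ((1 + a - b + N) * (1 + a - c + N) * (1 + a - d + N)) *
        dougallTerm a b c d (e - 1) N (i + 1) -
      (N + 1) * (N + e) * (b * c * d) *
        dougallTerm (a + 2) (b + 1) (c + 1) (d + 1) e N i := by
  have hw := poisedWeight_succ ha N (i + 1)
  have hw' := poisedWeight_succ_succ ha N i
  have hP : ∀ x, poisedFactor a x (N + 1) (i + 1) = x * poisedFactor (a + 2) (x + 1) N i :=
    fun x => poisedFactor_succ_succ a x N i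
  rcases hi.eq_or_lt with rfl | hlt
  · have h0 : poisedWeight a i (i + 1) = 0 := by simp [poisedWeight]
    have he : poisedFactor a e (i + 1) (i + 1) = (e + i) * poisedFactor (a + 2) e i i := by
      simp only [poisedFactor, Nat.sub_self, rising_zero, rising_succ]; ring
    simp only [dougallTerm, h0, hP b, hP c, hP d, he]
    linear_combination (e + i) * (b * c * d) * (poisedFactor (a + 2) (b + 1) i i *
      poisedFactor (a + 2) (c + 1) i i * poisedFactor (a + 2) (d + 1) i i *
      poisedFactor (a + 2) e i i) * hw'
  · obtain ⟨r, rfl⟩ := Nat.exists_eq_add_of_lt hlt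
    have hQ : ∀ x, poisedFactor a x (i + r + 1 + 1) (i + 1) =
        poisedFactor a x (i + r + 1) (i + 1) * (1 + a - x + (i + r + 1 : ℕ)) :=
      fun x => poisedFactor_succ a x (by omega)
    set core : K := rising e i * rising (2 + a - e + (i + 1)) r with hcore
    have e1 : poisedFactor a e (i + r + 1 + 1) (i + 1) = (e + i) * (1 + a - e + (i + 1)) * core := by
      simp only [poisedFactor, show i + r + 1 + 1 - (i + 1) = r + 1 by omega, hcore]
      rw [rising_succ, rising_succ']
      rw [show 1 + a - e + ((i + 1 : ℕ) : K) + 1 = 2 + a - e + (i + 1) by push_cast; ring]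
      push_cast; ring
    have e2 : poisedFactor a (e - 1) (i + r + 1) (i + 1) = (e - 1) * core := by
      simp only [poisedFactor, show i + r + 1 - (i + 1) = r by omega, hcore]
      rw [rising_succ', show 1 + a - (e - 1) + ((i + 1 : ℕ) : K) = 2 + a - e + (i + 1) by
        push_cast; ring, show e - 1 + 1 = e by ring]
      ring
    have e3 : poisedFactor (a + 2) e (i + r + 1) i = core * (a + (i + r + 1) + 2 - e) := by
      simp only [poisedFactor, show i + r + 1 - i = r + 1 by omega, hcore]
      rw [rising_succ, show 1 + (a + 2) - e + (i : K) = 2 + a - e + (i + 1) by ring]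
      ring
    have t1 : (i + r + 1 + 1) * ((1 + a - b + (i + r + 1 : ℕ)) * (1 + a - c + (i + r + 1 : ℕ)) *
        (1 + a - d + (i + r + 1 : ℕ))) * dougallTerm a b c d (e - 1) (i + r + 1) (i + 1) =
        - ((i + 1 - (i + r + 1 + 1)) * (a + (i + 1) + (i + r + 1) + 1)) *
          poisedWeight a (i + r + 1 + 1) (i + 1) *
          (poisedFactor a b (i + r + 1 + 1) (i + 1) * poisedFactor a c (i + r + 1 + 1) (i + 1) *
            poisedFactor a d (i + r + 1 + 1) (i + 1)) * ((e - 1) * core) := by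
      simp only [dougallTerm, hQ, e2]
      push_cast at hw ⊢
      generalize poisedFactor a b (i + r + 1) (i + 1) = p1
      generalize poisedFactor a c (i + r + 1) (i + 1) = p2
      generalize poisedFactor a d (i + r + 1) (i + 1) = p3
      linear_combination (p1 * p2 * p3 * ((1 + a - b + (i + r + 1)) * (1 + a - c + (i + r + 1)) *
        (1 + a - d + (i + r + 1))) * ((e - 1) * core)) * hw
    have t2 : (i + r + 1 + 1) * (b * c * d) *
          dougallTerm (a + 2) (b + 1) (c + 1) (d + 1) e (i + r + 1) i =
        - ((i + 1) * (a + i + 1)) * poisedWeight a (i + r + 1 + 1) (i + 1) *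
          (poisedFactor a b (i + r + 1 + 1) (i + 1) * poisedFactor a c (i + r + 1 + 1) (i + 1) *
            poisedFactor a d (i + r + 1 + 1) (i + 1)) * (core * (a + (i + r + 1) + 2 - e)) := by
      simp only [dougallTerm, hP, e3]
      push_cast at hw' ⊢
      generalize poisedFactor (a + 2) (b + 1) (i + r + 1) i = p1
      generalize poisedFactor (a + 2) (c + 1) (i + r + 1) i = p2
      generalize poisedFactor (a + 2) (d + 1) (i + r + 1) i = p3
      linear_combination (p1 * p2 * p3 * (b * c * d) * (core * (a + (i + r + 1) + 2 - e))) * hw'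
    have t0 : dougallTerm a b c d e (i + r + 1 + 1) (i + 1) =
        poisedWeight a (i + r + 1 + 1) (i + 1) *
          (poisedFactor a b (i + r + 1 + 1) (i + 1) * poisedFactor a c (i + r + 1 + 1) (i + 1) *
            poisedFactor a d (i + r + 1 + 1) (i + 1)) * ((e + i) * (1 + a - e + (i + 1)) * core) := by
      rw [dougallTerm, e1]; ring
    rw [t0]
    push_cast at t1 t2 ⊢
    generalize poisedWeight a (i + r + 1 + 1) (i + 1) = w at *
    generalize poisedFactor a b (i + r + 1 + 1) (i + 1) = p1 at *
    generalize poisedFactor a c (i + r + 1 + 1) (i + 1) = p2 at *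
    generalize poisedFactor a d (i + r + 1 + 1) (i + 1) = p3 at *
    linear_combination (-(a - e + 1)) * t1 + ((i + r + 1) + e) * t2

/-- **Dougall's theorem** for the terminating two-balanced very-well-poised `₇F₆`, with
denominators cleared. -/
theorem sum_dougallTerm [CharZero K] (N : ℕ) {a : K} (ha : ∀ n : ℕ, a ≠ -n) {b c d e : K}
    (he : b + c + d + e = 1 + 2 * a + N) :
    ∑ i ∈ range (N + 1), dougallTerm a b c d e N i =
      (-1) ^ N * (rising (1 + a - b - c) N * rising (1 + a - b - d) N *
        rising (1 + a - c - d) N) := by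
  induction N generalizing a b c d e with
  | zero =>
    have : a ≠ 0 := by simpa using ha 0
    simp [dougallTerm, poisedWeight, poisedFactor, rising_succ, this]
  | succ N ih =>
    push_cast at he
    have ha2 : ∀ n : ℕ, a + 2 ≠ -n := fun n h => ha (n + 2) (by push_cast; linear_combination h)
    -- Lowering `e` by 1, or raising `a` by 2 and each of `b, c, d` by 1, turns the balance
    -- condition for `N + 1` into the one for `N`.
    have i1 := ih ha (b := b) (c := c) (d := d) (e := e - 1) (by linear_combination he)
    have i2 := ih ha2 (b := b + 1) (c := c + 1) (d := d + 1) (e := e) (by linear_combination he)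
    have hN : (N : K) + 1 ≠ 0 := by exact_mod_cast N.succ_ne_zero
    have haN : a + N + 1 ≠ 0 := fun h => ha (N + 1) (by push_cast; linear_combination h)
    refine mul_left_cancel₀ (mul_ne_zero hN haN) ?_
    have hz : dougallTerm a b c d (e - 1) N (N + 1) = 0 := by simp [dougallTerm, poisedWeight]
    have key : ∑ i ∈ range (N + 1 + 1), (N + 1) * (a + N + 1) * dougallTerm a b c d e (N + 1) i =
        (N + 1) * (a - e + 1) * ((1 + a - b + N) * (1 + a - c + N) * (1 + a - d + N)) *
          ∑ i ∈ range (N + 1), dougallTerm a b c d (e - 1) N i -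
        (N + 1) * (N + e) * (b * c * d) *
          ∑ i ∈ range (N + 1), dougallTerm (a + 2) (b + 1) (c + 1) (d + 1) e N i := by
      rw [sum_range_succ', dougallTerm_zero ha,
        sum_congr rfl fun i hi => dougallTerm_succ ha b c d e (Nat.lt_succ_iff.1 (mem_range.1 hi)),
        sum_sub_distrib, ← mul_sum, ← mul_sum, sub_add_eq_add_sub, ← mul_add,
        ← sum_range_succ' (fun i => dougallTerm a b c d (e - 1) N i), sum_range_succ _ (N + 1), hz,
        add_zero]
    rw [mul_sum, key, i1, i2]
    rw [show 1 + (a + 2) - (b + 1) - (c + 1) = 1 + a - b - c by ring,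
      show 1 + (a + 2) - (b + 1) - (d + 1) = 1 + a - b - d by ring,
      show 1 + (a + 2) - (c + 1) - (d + 1) = 1 + a - c - d by ring]
    simp only [rising_succ]
    -- Eliminating `e` by the balance condition leaves a polynomial identity.
    obtain rfl : e = 2 + 2 * a + N - b - c - d := by linear_combination he
    ring

end Algebra

/-! ### Bailey's transformation by two applications of Dougall's theorem -/

section Transformation

variable {K : Type*} [Field K]

lemma rising_mul_reflect (y : K) (r m : ℕ) :
    rising y r * rising (1 - y - r - m) m = (-1) ^ m * rising y (r + m) := by
  rw [rising_add, show 1 - y - (r : K) - m = 1 - (y + r) - m by ring, rising_reflect]; ring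

/-- The product runs through `e - 1`: the `r` factors below it reverse into `rising (2 - e) r`, and
the `j` factors above it form `rising e j`. -/
lemma rising_around (e : K) (r j : ℕ) :
    rising (e - 1 - r) (j + r + 1) = (-1) ^ r * ((e - 1) * rising e j * rising (2 - e) r) := by
  have h := rising_reflect (2 - e) r
  rw [show 1 - (2 - e) - (r : K) = e - 1 - r by ring] at h
  rw [show j + r + 1 = r + (1 + j) by ring, rising_add, h, rising_add _ 1 j,
    show e - 1 - (r : K) + r = e - 1 by ring]
  simp only [rising_succ, rising_zero]
  rw [show e - 1 + ((1 : ℕ) : K) = e by push_cast; ring]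
  push_cast; ring

/-- The `n`-th coefficient of a `₄F₃` series, in terms of rising factorials. -/
def fourThreeCoeff (a b c d e f g : K) (n : ℕ) : K :=
  rising a n * rising b n * rising c n * rising d n /
    ((n ! : K) * rising e n * rising f n * rising g n)

/-- The terminating very-well-poised `₉F₈` with base `e - 1 - n`, up to normalization. Its first
and its last terms approximate the two series of `hypL`. -/
def twoSidedSum (a b c d e f g : K) (n : ℕ) : K :=
  ∑ j ∈ range (n + 1), (e - 1 - n + 2 * j) * (fourThreeCoeff a b c d e f g j *
    fourThreeCoeff (1 + a - e) (1 + b - e) (1 + c - e) (1 + d - e) (2 - e) (1 + f - e) (1 + g - e)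
      (n - j))

/-- The kernel through which the two `₉F₈` series are linked. -/
def linkKernel (e e' : K) (n j i : ℕ) : K :=
  (j.choose i : K) * (e' - 1 - n + 2 * i) / rising (e' - 1 - n + i) (j + 1) *
    rising (e - 1 - n + j) i * ((-1) ^ (j - i) * rising (e - e') (j - i))

/-- The parameters are chosen so that the factors depending on `c, d, g` separate from the rest. The
parameter `e - 1 - n + j` contributes only `e, e', n, i, j`, and becomes part of the kernel. -/
lemma dougallTerm_outer {c d e e' g : K} (he' : e' = e + g - c - d) {n i j : ℕ} (hij : i ≤ j)
    (hjn : j ≤ n) :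
    dougallTerm (e' - 1 - n) (g - d) (g - c) (e' - n - g) (e - 1 - n + j) j i *
        (rising (1 + c - e) (n - j) * rising (1 + d - e) (n - j)) *
        (rising (1 + g - e') (n - i) * rising g i) =
      rising g j * rising (1 + g - e') n * (rising (g - c) i * rising (1 + d - e) (n - i) *
        rising (g - d) i * rising (1 + c - e) (n - i)) * linkKernel e e' n j i := by
  obtain ⟨m, rfl⟩ := Nat.exists_eq_add_of_le hij
  obtain ⟨r, rfl⟩ := Nat.exists_eq_add_of_le hjn
  have hc := rising_mul_reflect (1 + c - e) r m
  have hd := rising_mul_reflect (1 + d - e) r m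
  have hg := rising_mul_reflect (1 + g - e') (m + r) i
  have hk := rising_reflect (e - e') m
  have hgi := rising_add g i m
  simp only [dougallTerm, poisedWeight, poisedFactor, linkKernel,
    show i + m + r - (i + m) = r by omega, show i + m - i = m by omega,
    show i + m + r - i = r + m by omega]
  rw [show 1 + (e' - 1 - ((i + m + r : ℕ) : K)) - (g - d) + i = 1 - (1 + c - e) - r - m by
      rw [he']; push_cast; ring,
    show 1 + (e' - 1 - ((i + m + r : ℕ) : K)) - (g - c) + i = 1 - (1 + d - e) - r - m by
      rw [he']; push_cast; ring,
    show e' - ((i + m + r : ℕ) : K) - g = 1 - (1 + g - e') - ((m + r : ℕ) : K) - i by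
      push_cast; ring,
    show 1 + (e' - 1 - ((i + m + r : ℕ) : K)) - (1 - (1 + g - e') - ((m + r : ℕ) : K) - i) + i =
      g + i by push_cast; ring,
    show 1 + (e' - 1 - ((i + m + r : ℕ) : K)) - (e - 1 - ((i + m + r : ℕ) : K) + ((i + m : ℕ) : K))
      + i = 1 - (e - e') - m by push_cast; ring, hk, hgi, show i + m + r = m + r + i by omega]
  rw [add_comm r m] at *
  have hs : ((-1 : K) ^ i) * (-1) ^ i = 1 := by rw [← mul_pow]; simp
  have hs' : ((-1 : K) ^ m) * (-1) ^ m = 1 := by rw [← mul_pow]; simp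
  generalize rising (1 - (1 + c - e) - (r : K) - m) m = x1 at *
  generalize rising (1 - (1 + d - e) - (r : K) - m) m = x2 at *
  generalize rising (1 - (1 + g - e') - ((m + r : ℕ) : K) - i) i = x3 at *
  generalize rising (1 + c - e) r = y1 at *
  generalize rising (1 + d - e) r = y2 at *
  generalize rising (1 + g - e') (m + r) = y3 at *
  generalize rising (1 + g - e') (m + r + i) = z3 at *
  generalize rising (1 + c - e) (m + r) = z1 at *
  generalize rising (1 + d - e) (m + r) = z2 at *
  generalize (-1 : K) ^ i = s at *
  generalize (-1 : K) ^ m = t at *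
  generalize rising (e' - 1 - ((m + r + i : ℕ) : K) + (i : K)) (i + m + 1) = D
  generalize rising (e - 1 - ((m + r + i : ℕ) : K) + ((i + m : ℕ) : K)) i = E
  generalize rising (e - e') m = F
  generalize rising g i = G1
  generalize rising (g + i) m = G2
  generalize rising (g - d) i = G3
  generalize rising (g - c) i = G4
  generalize ((i + m).choose i : K) = C
  calc _ = s * C * (e' - 1 - ((m + r + i : ℕ) : K) + 2 * i) / D * (G3 * G4 * G2 * E * t * F * G1) *
        ((y1 * x1) * (y2 * x2) * (y3 * x3)) := by ring
    _ = s * C * (e' - 1 - ((m + r + i : ℕ) : K) + 2 * i) / D * (G3 * G4 * G2 * E * t * F * G1) *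
        ((t * z1) * (t * z2) * (s * z3)) := by rw [hc, hd, hg]
    _ = (s * s) * (t * t) * (C * (e' - 1 - ((m + r + i : ℕ) : K) + 2 * i) / D *
        (G3 * G4 * G2 * E * t * F * G1) * (z1 * z2 * z3)) := by ring
    _ = _ := by rw [hs, hs']; ring

/-- Dougall's theorem of length `j` and base `e' - 1 - n`; its balance condition is exactly `e' = e
+ g - c - d`. -/
lemma sum_linkKernel_outer [CharZero K] {c d e e' g : K} (he' : e' = e + g - c - d) {n j : ℕ}
    (hjn : j ≤ n) (hint : ∀ z : ℤ, e' ≠ z) (hg : ∀ n : ℕ, g ≠ -n)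
    (hge : ∀ n : ℕ, 1 + g - e ≠ -n) (hge' : ∀ n : ℕ, 1 + g - e' ≠ -n) :
    rising (1 + g - e) n * (rising c j * rising (1 + c - e) (n - j) * rising d j *
        rising (1 + d - e) (n - j) / (rising g j * rising (1 + g - e) (n - j))) =
      rising (1 + g - e') n * ∑ i ∈ range (j + 1),
        (rising (g - c) i * rising (1 + d - e) (n - i) * rising (g - d) i *
          rising (1 + c - e) (n - i)) / (rising g i * rising (1 + g - e') (n - i)) *
        linkKernel e e' n j i := by
  -- The base moves left with `n`, so all integer values of `e'` must be excluded.
  have hk : ∀ m : ℕ, e' - 1 - n ≠ -m := fun m h =>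
    hint (1 + n - m) (by push_cast; linear_combination h)
  have hD := sum_dougallTerm j hk (b := g - d) (c := g - c) (d := e' - n - g) (e := e - 1 - n + j)
    (by rw [he']; ring)
  obtain ⟨r, rfl⟩ := Nat.exists_eq_add_of_le hjn
  have hgr := rising_mul_reflect (1 + g - e) r j
  rw [show 1 + (e' - 1 - ((j + r : ℕ) : K)) - (g - d) - (g - c) = 1 - (1 + g - e) - r - j by
      rw [he']; push_cast; ring,
    show 1 + (e' - 1 - ((j + r : ℕ) : K)) - (g - d) - (e' - ((j + r : ℕ) : K) - g) = d by ring,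
    show 1 + (e' - 1 - ((j + r : ℕ) : K)) - (g - c) - (e' - ((j + r : ℕ) : K) - g) = c by ring] at hD
  have h1 := rising_ne_zero hg
  have h2 := rising_ne_zero hge
  have h3 := rising_ne_zero hge'
  have hs : ((-1 : K) ^ j) * (-1) ^ j = 1 := by rw [← mul_pow]; simp
  have hT : ∀ i ∈ range (j + 1), rising (1 + g - e') (j + r) *
      ((rising (g - c) i * rising (1 + d - e) (j + r - i) * rising (g - d) i *
          rising (1 + c - e) (j + r - i)) / (rising g i * rising (1 + g - e') (j + r - i)) *
        linkKernel e e' (j + r) j i) = (rising (1 + c - e) r * rising (1 + d - e) r) / rising g j *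
      dougallTerm (e' - 1 - (j + r : ℕ)) (g - d) (g - c) (e' - (j + r : ℕ) - g)
        (e - 1 - (j + r : ℕ) + j) j i := by
    intro i hi
    have h := dougallTerm_outer he' (Nat.lt_succ_iff.1 (mem_range.1 hi)) (Nat.le_add_right j r)
    rw [show j + r - j = r by omega] at h
    have := h1 i; have := h1 j; have := h3 (j + r - i)
    field_simp
    linear_combination -h
  rw [mul_sum, sum_congr rfl hT, ← mul_sum, hD, show j + r - j = r by omega]
  have := h1 j; have := h2 r
  rw [add_comm j r]
  field_simp
  linear_combination (-(rising c j * rising (1 + c - e) r * rising d j * rising (1 + d - e) r)) *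
    ((-1) ^ j * hgr + rising (1 + g - e) (r + j) * hs)

-- With `j = i + m`, the kernel times the `a, b, f` part is a multiple, independent of `m`, of the
-- `m`-th Dougall term with base `e - 1 - n + 2 * i`. The kernel factor `rising (e - e') m` supplies
-- the fourth parameter `e - e'`.
set_option maxHeartbeats 800000 in
lemma dougallTerm_inner [CharZero K] {a b e e' f : K}
    (hint : ∀ z : ℤ, e ≠ z) (hint' : ∀ z : ℤ, e' ≠ z)
    (hf : ∀ n : ℕ, f ≠ -n) (hfe : ∀ n : ℕ, 1 + f - e ≠ -n) {n i j : ℕ} (hij : i ≤ j)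
    (hjn : j ≤ n) :
    (e - 1 - n + 2 * j) * (rising a j * rising (1 + a - e) (n - j) * rising b j *
        rising (1 + b - e) (n - j) / ((j ! : K) * ((n - j)! : K) * rising e j *
        rising (2 - e) (n - j) * rising f j * rising (1 + f - e) (n - j))) *
        linkKernel e e' n j i * (rising f n / (e - 1)) =
      (-1) ^ (n - i) * rising a i * rising b i * (e' - 1 - n + 2 * i) /
        (rising (1 + f - e) (n - i) * rising (e' - 1 - n + i) (n + 1) * (i ! : K) *
          ((n - i)! : K)) *
        dougallTerm (e - 1 - n + 2 * i) (a + i) (b + i) (e - n - f + i) (e - e') (n - i) (j - i) := by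
  obtain ⟨m, rfl⟩ := Nat.exists_eq_add_of_le hij
  obtain ⟨r, rfl⟩ := Nat.exists_eq_add_of_le hjn
  have nz : ∀ {x : K} (_ : ∀ z : ℤ, x ≠ z) (z : ℤ) (l : ℕ), rising (x + z) l ≠ 0 :=
    fun {x} hx z l => rising_ne_zero (fun n h => hx (-n - z) (by
      push_cast; linear_combination h)) l
  have hra := rising_add a i m
  have hrb := rising_add b i m
  have hpa := rising_reflect (1 + a - e) r
  have hpb := rising_reflect (1 + b - e) r
  have hrf := rising_add f (i + m) r
  have hyf := rising_mul_reflect (1 + f - e) r m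
  have hDn := rising_add (e' - 1 - (i + m + r : ℕ) + i) (i + m + 1) r
  have hEG := rising_around e r (i + m)
  have hEG' := rising_add (e - 1 - r) i (m + r + 1)
  have hC1 : ((i + m).choose i : K) * ((i ! : K) * (m ! : K)) = ((i + m)! : K) := by
    have := Nat.choose_mul_factorial_mul_factorial (Nat.le_add_right i m)
    rw [Nat.add_sub_cancel_left] at this
    rw [← this]; push_cast; ring
  have hC2 : ((m + r).choose m : K) * ((m ! : K) * (r ! : K)) = ((m + r)! : K) := by
    have := Nat.choose_mul_factorial_mul_factorial (Nat.le_add_right m r)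
    rw [Nat.add_sub_cancel_left] at this
    rw [← this]; push_cast; ring
  have n1 := rising_ne_zero hf (i + m)
  have n2 := rising_ne_zero hfe r
  have n3 := rising_ne_zero hfe (r + m)
  have n4 : rising (e' - 1 - (i + m + r : ℕ) + i) (i + m + 1 + r) ≠ 0 := by
    have := nz hint' (-1 - (i + m + r : ℕ) + i) (i + m + 1 + r)
    push_cast at this ⊢
    convert this using 2; ring
  have n5 : rising e (i + m) ≠ 0 := by simpa using nz hint 0 (i + m)
  have n6 : e - 1 ≠ 0 := fun h => hint 1 (by push_cast; linear_combination h)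
  have n7 : rising (2 - e) r ≠ 0 := rising_ne_zero (fun n h => hint (n + 2) (by
    push_cast; linear_combination -h)) r
  have n8 : rising (e - 1 - r + i) (m + r + 1) ≠ 0 := by
    have := nz hint (-1 - r + i) (m + r + 1)
    push_cast at this ⊢
    convert this using 2; ring
  have f1 : (i ! : K) ≠ 0 := by exact_mod_cast i.factorial_ne_zero
  have f2 : (m ! : K) ≠ 0 := by exact_mod_cast m.factorial_ne_zero
  have f3 : (r ! : K) ≠ 0 := by exact_mod_cast r.factorial_ne_zero
  have f4 : ((m + r)! : K) ≠ 0 := by exact_mod_cast (m + r).factorial_ne_zero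
  have f5 : ((i + m)! : K) ≠ 0 := by exact_mod_cast (i + m).factorial_ne_zero
  simp only [dougallTerm, poisedWeight, poisedFactor, linkKernel,
    show i + m + r - (i + m) = r by omega, show i + m - i = m by omega,
    show i + m + r - i = m + r by omega, show m + r - m = r by omega]
  rw [show 1 + (e - 1 - ((i + m + r : ℕ) : K) + 2 * i) - (a + i) + m = 1 - (1 + a - e) - r by
      push_cast; ring,
    show 1 + (e - 1 - ((i + m + r : ℕ) : K) + 2 * i) - (b + i) + m = 1 - (1 + b - e) - r by
      push_cast; ring,
    show 1 + (e - 1 - ((i + m + r : ℕ) : K) + 2 * i) - (e - ((i + m + r : ℕ) : K) - f + i) + m =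
      f + (i + m : ℕ) by push_cast; ring,
    show e - ((i + m + r : ℕ) : K) - f + i = 1 - (1 + f - e) - r - m by push_cast; ring,
    show 1 + (e - 1 - ((i + m + r : ℕ) : K) + 2 * i) - (e - e') + m =
      e' - 1 - (i + m + r : ℕ) + i + (i + m + 1 : ℕ) by push_cast; ring,
    show e - 1 - ((i + m + r : ℕ) : K) + 2 * i + m = e - 1 - r + i by push_cast; ring,
    show e - 1 - ((i + m + r : ℕ) : K) + ((i + m : ℕ) : K) = e - 1 - r by push_cast; ring,
    show i + m + r + 1 = i + m + 1 + r by omega, hra, hrb, hpa, hpb, hrf, hDn]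
  rw [show i + (m + r + 1) = i + m + r + 1 by omega, hEG] at hEG'
  rw [add_comm r m] at hyf n3
  rw [hDn] at n4
  obtain ⟨n41, n42⟩ := mul_ne_zero_iff.1 n4
  rw [show e - 1 - ((i + m + r : ℕ) : K) + 2 * ((i + m : ℕ) : K) = e - 1 - r + i + m by
      push_cast; ring,
    show e - 1 - ((i + m + r : ℕ) : K) + 2 * i + 2 * m = e - 1 - r + i + m by push_cast; ring]
  generalize rising (e' - 1 - ((i + m + r : ℕ) : K) + i + (i + m + 1 : ℕ)) r = Pk at *
  generalize rising (e' - 1 - ((i + m + r : ℕ) : K) + i) (i + m + 1) = Dj at *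
  generalize rising (e - 1 - (r : K) + i) (m + r + 1) = G at *
  generalize rising (e - 1 - (r : K)) i = E at *
  generalize rising (1 - (1 + f - e) - (r : K) - m) m = Rfm at *
  generalize rising (1 + f - e) r = yf at *
  generalize rising (1 + f - e) (m + r) = zf at *
  generalize rising (f + ((i + m : ℕ) : K)) r = Pf at *
  generalize rising f (i + m) = Rfj at *
  generalize rising e (i + m) = Re at *
  generalize rising (2 - e) r = R2 at *
  generalize ((i + m).choose i : K) = C1 at *
  generalize ((m + r).choose m : K) = C2 at *
  generalize ((i + m)! : K) = J at *
  generalize ((m + r)! : K) = N at *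
  generalize (i ! : K) = I at *
  generalize (m ! : K) = M at *
  generalize (r ! : K) = Q at *
  generalize e - 1 - (r : K) + i + m = α at *
  generalize e' - 1 - ((i + m + r : ℕ) : K) + 2 * i = κ at *
  generalize rising (e - e') m = F at *
  rw [pow_add]
  obtain rfl : Rfm = (-1) ^ m * zf / yf := by rw [eq_div_iff n2]; linear_combination hyf
  obtain rfl : E = (-1) ^ r * ((e - 1) * Re * R2) / G := by rw [eq_div_iff n8, hEG']
  subst hC1 hC2
  have hC1 := left_ne_zero_of_mul f5
  have hC2 := left_ne_zero_of_mul f4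
  have hs : ((-1 : K) ^ m) ^ 2 = 1 := by rw [← pow_mul, mul_comm, pow_mul]; simp
  have ht : ((-1 : K) ^ r) ^ 2 = 1 := by rw [← pow_mul, mul_comm, pow_mul]; simp
  have hs0 : (-1 : K) ^ m ≠ 0 := by simp
  have ht0 : (-1 : K) ^ r ≠ 0 := by simp
  generalize (-1 : K) ^ m = s at *
  generalize (-1 : K) ^ r = t at *
  clear hra hrb hpa hpb hrf hyf hDn hEG hEG' nz f4 f5
  field_simp
  rw [hs, ht]; ring

/-- Dougall's theorem of length `n - i`; its balance condition is exactly `e' = 1 + a + b - f`. -/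
lemma sum_linkKernel_inner [CharZero K] {a b e e' f : K} (he' : e' = 1 + a + b - f)
    (hint : ∀ z : ℤ, e ≠ z) (hint' : ∀ z : ℤ, e' ≠ z)
    (hf : ∀ n : ℕ, f ≠ -n) (hfe : ∀ n : ℕ, 1 + f - e ≠ -n)
    (hf' : ∀ n : ℕ, 1 + a + b - e ≠ -n) {n i : ℕ} (hin : i ≤ n) :
    (∑ j ∈ Ico i (n + 1), (e - 1 - n + 2 * j) * (rising a j * rising (1 + a - e) (n - j) *
        rising b j * rising (1 + b - e) (n - j) / ((j ! : K) * ((n - j)! : K) * rising e j *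
        rising (2 - e) (n - j) * rising f j * rising (1 + f - e) (n - j))) *
        linkKernel e e' n j i) * (rising f n / (e - 1)) =
      (rising (1 + a + b - e) n / (e' - 1)) * ((e' - 1 - n + 2 * i) *
        (rising a i * rising (1 + a - e') (n - i) *
        rising b i * rising (1 + b - e') (n - i) / ((i ! : K) * ((n - i)! : K) * rising e' i *
        rising (2 - e') (n - i) * rising (1 + a + b - e) i * rising (1 + f - e) (n - i)))) := by
  rw [sum_mul, sum_congr rfl fun j hj => dougallTerm_inner hint hint' hf hfe (mem_Ico.1 hj).1
    (Nat.lt_succ_iff.1 (mem_Ico.1 hj).2), ← mul_sum, sum_Ico_eq_sum_range]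
  obtain ⟨r, rfl⟩ := Nat.exists_eq_add_of_le hin
  simp only [Nat.add_sub_cancel_left, show i + r + 1 - i = r + 1 by omega]
  rw [sum_dougallTerm r (fun m h => hint (1 + r - i - m) (by
      push_cast at h ⊢; linear_combination h)) (by rw [he']; push_cast; ring)]
  have h1 := rising_reflect (1 + a + b - e + i) r
  rw [show 1 + (e - 1 - ((i + r : ℕ) : K) + 2 * i) - (a + i) - (b + i) =
      1 - (1 + a + b - e + i) - r by push_cast; ring,
    show 1 + (e - 1 - ((i + r : ℕ) : K) + 2 * i) - (a + i) - (e - ((i + r : ℕ) : K) - f + i) =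
      1 + b - e' by rw [he']; ring,
    show 1 + (e - 1 - ((i + r : ℕ) : K) + 2 * i) - (b + i) - (e - ((i + r : ℕ) : K) - f + i) =
      1 + a - e' by rw [he']; ring, h1, rising_add _ i r,
    show e' - 1 - ((i + r : ℕ) : K) + i = e' - 1 - r by push_cast; ring, rising_around]
  have n2 := rising_ne_zero hfe r
  have n3 := rising_ne_zero hf' i
  have n5 : rising e' i ≠ 0 := rising_ne_zero (fun n h => hint' (-n) (by
    push_cast; linear_combination h)) i
  have n6 : e' - 1 ≠ 0 := fun h => hint' 1 (by push_cast; linear_combination h)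
  have n7 : rising (2 - e') r ≠ 0 := rising_ne_zero (fun n h => hint' (n + 2) (by
    push_cast; linear_combination -h)) r
  have f1 : (i ! : K) ≠ 0 := by exact_mod_cast i.factorial_ne_zero
  have f3 : (r ! : K) ≠ 0 := by exact_mod_cast r.factorial_ne_zero
  rcases neg_one_pow_eq_or K r with h' | h' <;> rw [h'] <;> field_simp

/-- **Bailey's transformation** between two terminating very-well-poised `₉F₈` series. -/
theorem twoSidedSum_transform [CharZero K] {a b c d e f g : K}
    (hV : e + f + g - a - b - c - d = 1)
    (hint : ∀ z : ℤ, e ≠ z) (hint' : ∀ z : ℤ, 1 + a + b - f ≠ z)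
    (hf : ∀ n : ℕ, f ≠ -n) (hfe : ∀ n : ℕ, 1 + f - e ≠ -n)
    (hf' : ∀ n : ℕ, 1 + a + b - e ≠ -n) (hg : ∀ n : ℕ, g ≠ -n)
    (hge : ∀ n : ℕ, 1 + g - e ≠ -n) (hge' : ∀ n : ℕ, 1 + g - (1 + a + b - f) ≠ -n) (n : ℕ) :
    rising (1 + g - e) n * (rising f n / (e - 1)) * twoSidedSum a b c d e f g n =
      rising (1 + g - (1 + a + b - f)) n * (rising (1 + a + b - e) n / (1 + a + b - f - 1)) *
        twoSidedSum a b (g - c) (g - d) (1 + a + b - f) (1 + a + b - e) g n := by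
  obtain ⟨e', he'⟩ : ∃ e', e' = 1 + a + b - f := ⟨_, rfl⟩
  -- The two descriptions of `e'` feed the two uses of Dougall's theorem.
  have he'' : e' = e + g - c - d := by linear_combination he' - hV
  rw [← he'] at hint' hge' ⊢
  set U : ℕ → K := fun j => (e - 1 - n + 2 * j) * (rising a j * rising (1 + a - e) (n - j) *
        rising b j * rising (1 + b - e) (n - j) / ((j ! : K) * ((n - j)! : K) * rising e j *
        rising (2 - e) (n - j) * rising f j * rising (1 + f - e) (n - j))) with hU
  set Q : ℕ → K := fun i => (rising (g - c) i * rising (1 + d - e) (n - i) * rising (g - d) i *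
          rising (1 + c - e) (n - i)) / (rising g i * rising (1 + g - e') (n - i)) with hQ
  have s1 : rising (1 + g - e) n * twoSidedSum a b c d e f g n =
      ∑ j ∈ range (n + 1), ∑ i ∈ range (j + 1),
        rising (1 + g - e') n * (Q i * (U j * linkKernel e e' n j i)) := by
    rw [twoSidedSum, mul_sum]
    refine sum_congr rfl fun j hj => ?_
    have h := sum_linkKernel_outer he'' (Nat.lt_succ_iff.1 (mem_range.1 hj)) hint' hg hge hge'
    calc _ = U j * (rising (1 + g - e) n * (rising c j * rising (1 + c - e) (n - j) * rising d j *
        rising (1 + d - e) (n - j) / (rising g j * rising (1 + g - e) (n - j)))) := by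
          simp only [hU, fourThreeCoeff, div_eq_mul_inv, mul_inv]; ring
      _ = _ := by
          rw [h, mul_sum, mul_sum]
          exact sum_congr rfl fun i _ => by simp only [hQ]; ring
  have s2 : ∑ j ∈ range (n + 1), ∑ i ∈ range (j + 1),
        rising (1 + g - e') n * (Q i * (U j * linkKernel e e' n j i)) =
      ∑ i ∈ range (n + 1), ∑ j ∈ Ico i (n + 1),
        rising (1 + g - e') n * (Q i * (U j * linkKernel e e' n j i)) :=
    sum_comm' fun j i => by simp only [mem_range, mem_Ico]; omega
  rw [mul_right_comm, s1, s2, sum_mul, twoSidedSum, mul_sum]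
  refine sum_congr rfl fun i hi => ?_
  have h := sum_linkKernel_inner he' hint hint' hf hfe hf' (Nat.lt_succ_iff.1 (mem_range.1 hi))
  rw [← mul_sum, ← mul_sum]
  calc _ = rising (1 + g - e') n * Q i *
        ((∑ j ∈ Ico i (n + 1), U j * linkKernel e e' n j i) * (rising f n / (e - 1))) := by ring
    _ = _ := by
      rw [h]
      simp only [hQ, fourThreeCoeff]
      rw [show 1 + (g - c) - e' = 1 + d - e by rw [he'']; ring,
        show 1 + (g - d) - e' = 1 + c - e by rw [he'']; ring,
        show 1 + (1 + a + b - e) - e' = 1 + f - e by rw [he']; ring]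
      simp only [div_eq_mul_inv, mul_inv]; ring

end Transformation

/-! ### Limits of weighted convolutions -/

section Limits

lemma exists_bound_of_tendsto_sq_mul {r : ℕ → ℂ} {R : ℂ}
    (hr : Tendsto (fun n : ℕ => ((n : ℂ) + 1) ^ 2 * r n) atTop (𝓝 R)) :
    ∃ C : ℝ, 0 ≤ C ∧ ∀ n : ℕ, ((n : ℝ) + 1) ^ 2 * ‖r n‖ ≤ C := by
  obtain ⟨C, hC⟩ := (Metric.isBounded_range_of_tendsto _ hr).exists_norm_le
  have h : ∀ n : ℕ, ((n : ℝ) + 1) ^ 2 * ‖r n‖ ≤ C := fun n => by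
    have := hC _ ⟨n, rfl⟩
    have h1 : ‖(n : ℂ) + 1‖ = (n : ℝ) + 1 := by exact_mod_cast Complex.norm_natCast (n + 1)
    simpa only [norm_mul, norm_pow, h1] using this
  exact ⟨C, le_trans (by positivity) (h 0), h⟩

lemma summable_norm_of_tendsto_sq_mul {r : ℕ → ℂ} {R : ℂ}
    (hr : Tendsto (fun n : ℕ => ((n : ℂ) + 1) ^ 2 * r n) atTop (𝓝 R)) :
    Summable fun n => ‖r n‖ := by
  obtain ⟨C, -, hC⟩ := exists_bound_of_tendsto_sq_mul hr
  have hs : Summable fun n : ℕ => C * (1 / ((n + 1 : ℕ) : ℝ) ^ 2) :=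
    ((summable_nat_add_iff 1).2 (Real.summable_one_div_nat_pow.2 one_lt_two)).mul_left C
  refine hs.of_nonneg_of_le (fun n => norm_nonneg _) fun n => ?_
  rw [mul_one_div, le_div_iff₀ (by positivity), mul_comm]
  exact_mod_cast hC n

/-- On the half `2 * j ≤ n` the index `n - j` is at least `n / 2`, so the decay of `q (n - j)`
absorbs the quadratic weight. The terms are thus dominated by a constant times `‖r j‖`, and
dominated convergence applies. -/
lemma tendsto_sum_half {r q : ℕ → ℂ} {R Q : ℂ} (κ : ℂ) (p : ℕ → ℕ → Prop)
    [∀ n j, Decidable (p n j)] (hp : ∀ n j, p n j → 2 * j ≤ n)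
    (hp' : ∀ j, ∀ᶠ n in atTop, p n j)
    (hr : Tendsto (fun n : ℕ => ((n : ℂ) + 1) ^ 2 * r n) atTop (𝓝 R))
    (hq : Tendsto (fun n : ℕ => ((n : ℂ) + 1) ^ 2 * q n) atTop (𝓝 Q)) :
    Tendsto (fun n : ℕ => ∑ j ∈ range (n + 1),
      if p n j then n * (κ + n - 2 * j) * (r j * q (n - j)) else 0) atTop
      (𝓝 (Q * ∑' j, r j)) := by
  obtain ⟨C, hC0, hC⟩ := exists_bound_of_tendsto_sq_mul hq
  have hsum : ∀ n : ℕ, (∑ j ∈ range (n + 1),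
      if p n j then n * (κ + n - 2 * j) * (r j * q (n - j)) else 0) =
      ∑' j, if p n j then n * (κ + n - 2 * j) * (r j * q (n - j)) else 0 := fun n =>
    (tsum_eq_sum fun j hj => if_neg fun h => hj (mem_range.2 (by have := hp n j h; omega))).symm
  simp only [hsum]
  rw [← tsum_mul_left]
  refine tendsto_tsum_of_dominated_convergence
    (bound := fun j => ‖r j‖ * (2 * (‖κ‖ + 1) * C))
    ((summable_norm_of_tendsto_sq_mul hr).mul_right _) (fun j => ?_) (Eventually.of_forall ?_)
  · have h1 : Tendsto (fun m : ℕ => ((m : ℂ) + 1)⁻¹) atTop (𝓝 0) := by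
      simpa [one_div] using tendsto_one_div_add_atTop_nhds_zero_nat (𝕜 := ℂ)
    -- With `n = m + j`, the weight `n * (κ + n - 2 * j)` is `(m + 1) ^ 2` times the first two
    -- factors.
    have h2 : Tendsto (fun m : ℕ => (1 + (j - 1) * ((m : ℂ) + 1)⁻¹) *
        (1 + (κ - j - 1) * ((m : ℂ) + 1)⁻¹) * r j * (((m : ℂ) + 1) ^ 2 * q m)) atTop
        (𝓝 ((1 + (j - 1) * 0) * (1 + (κ - j - 1) * 0) * r j * Q)) :=
      ((((h1.const_mul _).const_add _).mul ((h1.const_mul _).const_add _)).mul_const _).mul hq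
    rw [show (1 + ((j : ℂ) - 1) * 0) * (1 + (κ - j - 1) * 0) * r j * Q = Q * r j by ring] at h2
    rw [← tendsto_add_atTop_iff_nat j]
    refine h2.congr' ?_
    filter_upwards [(tendsto_add_atTop_nat j).eventually (hp' j)] with m hm
    rw [if_pos hm, Nat.add_sub_cancel]
    have : (m : ℂ) + 1 ≠ 0 := by exact_mod_cast m.succ_ne_zero
    push_cast
    field_simp
    ring
  · intro n j
    split_ifs with h
    · have hjn := hp n j h
      obtain ⟨m, rfl⟩ := Nat.exists_eq_add_of_le (show j ≤ n by omega)
      rw [Nat.add_sub_cancel_left]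
      have hm := hC m
      have hjm : (j : ℝ) ≤ m := by exact_mod_cast (show j ≤ m by omega)
      have e1 : ‖((j + m : ℕ) : ℂ)‖ ≤ 2 * ((m : ℝ) + 1) := by
        rw [Complex.norm_natCast]; push_cast; linarith
      have e2 : ‖κ + ((j + m : ℕ) : ℂ) - 2 * j‖ ≤ (‖κ‖ + 1) * ((m : ℝ) + 1) := by
        have : κ + ((j + m : ℕ) : ℂ) - 2 * j = κ + ((m - j : ℕ) : ℂ) := by
          rw [Nat.cast_sub (by omega)]; push_cast; ring
        rw [this]
        refine (norm_add_le _ _).trans ?_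
        rw [Complex.norm_natCast, Nat.cast_sub (by omega)]
        have := norm_nonneg κ
        have hj0 : (0 : ℝ) ≤ j := j.cast_nonneg
        have hm0 : (0 : ℝ) ≤ m := m.cast_nonneg
        nlinarith
      rw [norm_mul, norm_mul, norm_mul]
      calc _ ≤ 2 * ((m : ℝ) + 1) * ((‖κ‖ + 1) * ((m : ℝ) + 1)) * (‖r j‖ * ‖q m‖) := by gcongr
        _ = ‖r j‖ * (2 * (‖κ‖ + 1) * (((m : ℝ) + 1) ^ 2 * ‖q m‖)) := by ring
        _ ≤ _ := by gcongr
    · rw [norm_zero]; positivity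

/-- Both ends of an antisymmetrically weighted convolution contribute to its limit. -/
lemma tendsto_weighted_convolution {r q : ℕ → ℂ} {R Q : ℂ} (κ : ℂ)
    (hr : Tendsto (fun n : ℕ => ((n : ℂ) + 1) ^ 2 * r n) atTop (𝓝 R))
    (hq : Tendsto (fun n : ℕ => ((n : ℂ) + 1) ^ 2 * q n) atTop (𝓝 Q)) :
    Tendsto (fun n : ℕ => n * ∑ j ∈ range (n + 1), (κ - n + 2 * j) * (r j * q (n - j))) atTop
      (𝓝 (R * ∑' j, q j - Q * ∑' j, r j)) := by
  -- Weak inequality for one half and strict for the reflected half, so that the middle term is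
  -- counted once.
  have h1 := tendsto_sum_half (-κ) (fun n j => 2 * j ≤ n) (fun _ _ h => h)
    (fun j => eventually_ge_atTop (2 * j)) hr hq
  have h2 := tendsto_sum_half κ (fun n j => 2 * j < n) (fun _ _ h => h.le)
    (fun j => eventually_gt_atTop (2 * j)) hq hr
  refine (h2.sub h1).congr fun n => ?_
  rw [← sum_range_reflect, ← sum_sub_distrib, mul_sum]
  refine sum_congr rfl fun j hj => ?_
  obtain ⟨m, rfl⟩ := Nat.exists_eq_add_of_le (Nat.lt_succ_iff.1 (mem_range.1 hj))
  rw [show j + m + 1 - 1 - j = m by omega, show j + m - m = j by omega,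
    show j + m - j = m by omega]
  rcases le_or_gt j m with h | h
  · rw [if_neg (by omega), if_pos (by omega)]; push_cast; ring
  · rw [if_pos (by omega), if_neg (by omega)]; push_cast; ring

/-! ### Gamma asymptotics of rising factorials and coefficients -/

lemma tendsto_rising_div_inv_Gamma (s : ℂ) :
    Tendsto (fun n : ℕ => rising s (n + 1) / ((n : ℂ) ^ s * (n ! : ℂ))) atTop
      (𝓝 (Complex.Gamma s)⁻¹) := by
  by_cases hs : ∀ m : ℕ, s ≠ -m
  · refine ((Complex.GammaSeq_tendsto_Gamma s).inv₀ (Complex.Gamma_ne_zero hs)).congr fun n => ?_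
    rw [Complex.GammaSeq, inv_div]; rfl
  -- At a pole the rising factorials eventually vanish, in agreement with the value `0` assigned to
  -- `Complex.Gamma` there.
  · push Not at hs
    obtain ⟨m, rfl⟩ := hs
    rw [Complex.Gamma_neg_nat_eq_zero, inv_zero]
    refine tendsto_const_nhds.congr' ?_
    filter_upwards [eventually_ge_atTop m] with n hn
    rw [rising, prod_eq_zero (mem_range.2 (Nat.lt_succ_of_le hn)) (by simp), zero_div]

lemma rising_one (n : ℕ) : rising (1 : ℂ) n = (n ! : ℂ) := by
  induction n with
  | zero => simp
  | succ n ih => rw [rising_succ, ih, Nat.factorial_succ]; push_cast; ring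

lemma tendsto_sq_mul_fourThreeCoeff {a b c d e f g : ℂ} (hV : e + f + g - a - b - c - d = 1)
    (he : ∀ n : ℕ, e ≠ -n) (hf : ∀ n : ℕ, f ≠ -n) (hg : ∀ n : ℕ, g ≠ -n) :
    Tendsto (fun n : ℕ => ((n : ℂ) + 1) ^ 2 * fourThreeCoeff a b c d e f g n) atTop
      (𝓝 (Complex.Gamma e * Complex.Gamma f * Complex.Gamma g *
        ((Complex.Gamma a)⁻¹ * (Complex.Gamma b)⁻¹ * (Complex.Gamma c)⁻¹ *
          (Complex.Gamma d)⁻¹))) := by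
  have T := tendsto_rising_div_inv_Gamma
  -- At the shifted index `n + 1` the square is `(n + 2) ^ 2`, which is `n ^ 2` times this factor.
  have hI : Tendsto (fun n : ℕ => (1 + 2 * ((n : ℂ))⁻¹) ^ 2) atTop (𝓝 ((1 + 2 * 0) ^ 2)) :=
    ((tendsto_inv_atTop_nhds_zero_nat (𝕜 := ℂ)).const_mul 2 |>.const_add 1).pow 2
  have h := hI.mul (((((T a).mul (T b)).mul (T c)).mul (T d)).div
    ((((T 1).mul (T e)).mul (T f)).mul (T g)) (by
      simp [Complex.Gamma_ne_zero he, Complex.Gamma_ne_zero hf, Complex.Gamma_ne_zero hg]))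
  rw [← tendsto_add_atTop_iff_nat 1]
  have hlim : (1 + 2 * 0 : ℂ) ^ 2 * ((Complex.Gamma a)⁻¹ * (Complex.Gamma b)⁻¹ *
      (Complex.Gamma c)⁻¹ * (Complex.Gamma d)⁻¹ / ((Complex.Gamma 1)⁻¹ * (Complex.Gamma e)⁻¹ *
      (Complex.Gamma f)⁻¹ * (Complex.Gamma g)⁻¹)) = Complex.Gamma e * Complex.Gamma f *
      Complex.Gamma g * ((Complex.Gamma a)⁻¹ * (Complex.Gamma b)⁻¹ * (Complex.Gamma c)⁻¹ *
      (Complex.Gamma d)⁻¹) := by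
    rw [Complex.Gamma_one, div_eq_mul_inv]
    simp only [mul_inv, inv_inv]
    ring
  rw [← hlim]
  refine h.congr' ?_
  filter_upwards [eventually_ne_atTop 0] with n hn
  have hn' : (n : ℂ) ≠ 0 := by exact_mod_cast hn
  -- Balance fixes the decay exponent: `1 + e + f + g = 2 + a + b + c + d`. The parameter `1`
  -- accounts for the factorial.
  have hpow : (n : ℂ) ^ (1 : ℂ) * (n : ℂ) ^ e * (n : ℂ) ^ f * (n : ℂ) ^ g =
      (n : ℂ) ^ 2 * ((n : ℂ) ^ a * (n : ℂ) ^ b * (n : ℂ) ^ c * (n : ℂ) ^ d) := by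
    rw [← Complex.cpow_natCast, ← Complex.cpow_add _ _ hn', ← Complex.cpow_add _ _ hn',
      ← Complex.cpow_add _ _ hn', ← Complex.cpow_add _ _ hn', ← Complex.cpow_add _ _ hn',
      ← Complex.cpow_add _ _ hn', ← Complex.cpow_add _ _ hn']
    congr 1
    push_cast
    linear_combination hV
  have nz : ∀ s : ℂ, (n : ℂ) ^ s ≠ 0 := fun s => by simp [Complex.cpow_eq_zero_iff, hn']
  have n1 := nz 1; have n2 := nz e; have n3 := nz f; have n4 := nz g
  have n5 := nz a; have n6 := nz b; have n7 := nz c; have n8 := nz d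
  have f1 : (n ! : ℂ) ≠ 0 := by exact_mod_cast n.factorial_ne_zero
  have f2 : ((n + 1)! : ℂ) ≠ 0 := by exact_mod_cast (n + 1).factorial_ne_zero
  have r1 := rising_ne_zero he (n + 1)
  have r2 := rising_ne_zero hf (n + 1)
  have r3 := rising_ne_zero hg (n + 1)
  simp only [Pi.div_apply]
  rw [fourThreeCoeff, rising_one]
  generalize (n : ℂ) ^ (1 : ℂ) = x1 at *
  generalize (n : ℂ) ^ a = x2 at *
  generalize (n : ℂ) ^ b = x3 at *
  generalize (n : ℂ) ^ c = x4 at *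
  generalize (n : ℂ) ^ d = x5 at *
  generalize (n : ℂ) ^ e = x6 at *
  generalize (n : ℂ) ^ f = x7 at *
  generalize (n : ℂ) ^ g = x8 at *
  push_cast
  field_simp
  linear_combination ((n + 2) ^ 2 * (rising a (n + 1) * rising b (n + 1) * rising c (n + 1) *
    rising d (n + 1))) * hpow

/-- Equal parameter sums make the powers of `n` cancel, leaving only the Gamma values. -/
lemma tendsto_rising_ratio {s t u v : ℂ} (h : s + t = u + v) (hu : ∀ n : ℕ, u ≠ -n)
    (hv : ∀ n : ℕ, v ≠ -n) :
    Tendsto (fun n : ℕ => rising s (n + 1) * rising t (n + 1) /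
      (rising u (n + 1) * rising v (n + 1))) atTop
      (𝓝 ((Complex.Gamma s)⁻¹ * (Complex.Gamma t)⁻¹ /
        ((Complex.Gamma u)⁻¹ * (Complex.Gamma v)⁻¹))) := by
  have T := tendsto_rising_div_inv_Gamma
  refine (((T s).mul (T t)).div ((T u).mul (T v)) (by
    simp [Complex.Gamma_ne_zero hu, Complex.Gamma_ne_zero hv])).congr' ?_
  filter_upwards [eventually_ne_atTop 0] with n hn
  have hn' : (n : ℂ) ≠ 0 := by exact_mod_cast hn
  have hpow : (n : ℂ) ^ s * (n : ℂ) ^ t = (n : ℂ) ^ u * (n : ℂ) ^ v := by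
    rw [← Complex.cpow_add _ _ hn', ← Complex.cpow_add _ _ hn', h]
  have nz : ∀ s : ℂ, (n : ℂ) ^ s ≠ 0 := fun s => by simp [Complex.cpow_eq_zero_iff, hn']
  have n1 := nz s; have n2 := nz t; have n3 := nz u; have n4 := nz v
  have f1 : (n ! : ℂ) ≠ 0 := by exact_mod_cast n.factorial_ne_zero
  have r1 := rising_ne_zero hu (n + 1)
  have r2 := rising_ne_zero hv (n + 1)
  simp only [Pi.div_apply]
  rw [div_mul_div_comm, div_mul_div_comm, div_div_div_eq,
    mul_mul_mul_comm ((n : ℂ) ^ s), hpow]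
  field_simp

/-! ### Return to `hypL`: convergence and the limit formula -/

lemma ascPochhammer_eval_eq_rising (x : ℂ) (n : ℕ) : (ascPochhammer ℂ n).eval x = rising x n := by
  induction n with
  | zero => simp
  | succ n ih => rw [ascPochhammer_succ_eval, rising_succ, ih]

lemma hypergeometricTerm_eq_fourThreeCoeff (a b c d e f g : ℂ) :
    hypergeometricTerm ![a, b, c, d] ![e, f, g] 1 = fourThreeCoeff a b c d e f g := by
  ext n
  simp [hypergeometricTerm, fourThreeCoeff, Fin.prod_univ_succ, ascPochhammer_eval_eq_rising,
    mul_assoc]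

lemma HypLAdmissible.ne_int {e f g : ℂ} (h : HypLAdmissible e f g) (z : ℤ) : e ≠ z := by
  rintro rfl
  refine h.sin_ne ?_
  rw [mul_comm]
  exact Complex.sin_int_mul_pi z

lemma HypLAdmissible.converges {a b c d e f g : ℂ} (hV : e + f + g - a - b - c - d = 1)
    (h : HypLAdmissible e f g) : HypLConverges a b c d e f g := by
  simp only [HypLConverges, hypergeometricTerm_eq_fourThreeCoeff]
  refine ⟨summable_norm_of_tendsto_sq_mul (tendsto_sq_mul_fourThreeCoeff hV
    (fun n => (h.fst n).1) (fun n => (h.fst n).2.1) (fun n => (h.fst n).2.2)),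
    summable_norm_of_tendsto_sq_mul (tendsto_sq_mul_fourThreeCoeff (by linear_combination hV)
    (fun n => (h.snd n).1) (fun n => (h.snd n).2.1) (fun n => (h.snd n).2.2))⟩

/-- The function `L` is the limit of rescaled terminating very-well-poised `₉F₈` series. -/
lemma tendsto_twoSidedSum {a b c d e f g : ℂ} (hV : e + f + g - a - b - c - d = 1)
    (h : HypLAdmissible e f g) :
    Tendsto (fun n : ℕ => n * (twoSidedSum a b c d e f g n / (e - 1))) atTop
      (𝓝 (Real.pi * Complex.Gamma f * Complex.Gamma g * Complex.Gamma (1 + f - e) *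
        Complex.Gamma (1 + g - e) * hypL a b c d e f g)) := by
  have h1 := tendsto_sq_mul_fourThreeCoeff hV
    (fun n => (h.fst n).1) (fun n => (h.fst n).2.1) (fun n => (h.fst n).2.2)
  have h2 := tendsto_sq_mul_fourThreeCoeff (a := 1 + a - e) (b := 1 + b - e) (c := 1 + c - e)
    (d := 1 + d - e) (e := 2 - e) (f := 1 + f - e) (g := 1 + g - e) (by linear_combination hV)
    (fun n => (h.snd n).2.2) (fun n => (h.snd n).1) (fun n => (h.snd n).2.1)
  have h3 := (tendsto_weighted_convolution (e - 1) h1 h2).div_const (e - 1)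
  have he1 : e - 1 ≠ 0 := fun h' => h.ne_int 1 (by push_cast; linear_combination h')
  have hπ : (Real.pi : ℂ) ≠ 0 := by exact_mod_cast Real.pi_ne_zero
  -- The reflection formula is the source of `sin (π e)` in `L`; the factor `e - 1` it brings
  -- cancels the division by `e - 1` in the limit.
  have hrefl : Complex.Gamma e * Complex.Gamma (2 - e) =
      -(e - 1) * (Real.pi / Complex.sin (Real.pi * e)) := by
    rw [← Complex.Gamma_mul_Gamma_one_sub, show 2 - e = (1 - e) + 1 by ring,
      Complex.Gamma_add_one _ (fun h' => he1 (by linear_combination -h'))]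
    ring
  have g1 := Complex.Gamma_ne_zero fun n => (h.fst n).1
  have g2 := Complex.Gamma_ne_zero fun n => (h.fst n).2.1
  have g3 := Complex.Gamma_ne_zero fun n => (h.fst n).2.2
  have g4 := Complex.Gamma_ne_zero fun n => (h.snd n).1
  have g5 := Complex.Gamma_ne_zero fun n => (h.snd n).2.1
  have g6 := Complex.Gamma_ne_zero fun n => (h.snd n).2.2
  have hs := h.sin_ne
  have hsum : fourThreeCoeff (1 + a - e) (1 + b - e) (1 + c - e) (1 + d - e) (2 - e) (1 + f - e)
      (1 + g - e) = fourThreeCoeff (1 + a - e) (1 + b - e) (1 + c - e) (1 + d - e) (1 + f - e)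
      (1 + g - e) (2 - e) := by
    ext n; simp only [fourThreeCoeff]; congr 1; ring
  rw [hsum] at h3
  convert h3 using 2
  · rw [twoSidedSum, ← hsum, mul_div_assoc]
  · simp only [hypL, hypergeometricSum, hypergeometricTerm_eq_fourThreeCoeff]
    have hG : Complex.Gamma (2 - e) =
        -(e - 1) * Real.pi / (Complex.sin (Real.pi * e) * Complex.Gamma e) := by
      rw [eq_div_iff (mul_ne_zero hs g1)]
      rw [← mul_div_assoc, eq_div_iff hs] at hrefl
      linear_combination hrefl
    rw [hG]
    generalize ∑' n, fourThreeCoeff a b c d e f g n = S1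
    generalize (∑' n, fourThreeCoeff (1 + a - e) (1 + b - e) (1 + c - e) (1 + d - e) (1 + f - e)
      (1 + g - e) (2 - e) n) = S2
    simp only [div_eq_mul_inv, mul_inv]
    field_simp
    ring

end Limits

end

theorem proposition3p2 (a b c d e f g : ℂ)
    (hV : e + f + g - a - b - c - d = 1)
    (h : HypLAdmissible e f g)
    (h' : HypLAdmissible (1 + a + b - f) (1 + a + b - e) g) :
    HypLConverges a b c d e f g ∧
    HypLConverges a b (g - c) (g - d) (1 + a + b - f) (1 + a + b - e) g ∧
    hypL a b c d e f g =
      hypL a b (g - c) (g - d) (1 + a + b - f) (1 + a + b - e) g := by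
  have hV' : (1 + a + b - f) + (1 + a + b - e) + g - a - b - (g - c) - (g - d) = 1 := by
    linear_combination -hV
  refine ⟨h.converges hV, h'.converges hV', ?_⟩
  have hf := fun n => (h.fst n).2.1
  have hg := fun n => (h.fst n).2.2
  have hfe := fun n => (h.snd n).1
  have hge := fun n => (h.snd n).2.1
  have hf' := fun n => (h'.fst n).2.1
  have hge' := fun n => (h'.snd n).2.1
  have hkey := twoSidedSum_transform hV h.ne_int h'.ne_int hf hfe hf' hg hge hge'
  -- The shift to `n + 1` matches the index in `tendsto_rising_ratio`.
  have t1 := (Filter.tendsto_add_atTop_iff_nat 1).2 (tendsto_twoSidedSum hV h)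
  have t2 := (Filter.tendsto_add_atTop_iff_nat 1).2 (tendsto_twoSidedSum hV' h')
  have hr := tendsto_rising_ratio (s := 1 + g - (1 + a + b - f)) (t := 1 + a + b - e)
    (u := 1 + g - e) (v := f) (by ring) hge hf
  have hlim := tendsto_nhds_unique t1 ((hr.mul t2).congr fun n => ?_)
  · have g2 := Complex.Gamma_ne_zero hf
    have g3 := Complex.Gamma_ne_zero hg
    have g4 := Complex.Gamma_ne_zero hfe
    have g5 := Complex.Gamma_ne_zero hge
    have g6 := Complex.Gamma_ne_zero hf'
    have g7 := Complex.Gamma_ne_zero hge'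
    have hπ : (Real.pi : ℂ) ≠ 0 := by exact_mod_cast Real.pi_ne_zero
    -- The quantity `1 + f - e` is unchanged by the transformation, so the remaining Gamma factors
    -- on both sides agree and are nonzero.
    rw [show 1 + (1 + a + b - e) - (1 + a + b - f) = 1 + f - e by ring] at hlim
    generalize hypL a b c d e f g = L1 at *
    generalize hypL a b (g - c) (g - d) (1 + a + b - f) (1 + a + b - e) g = L2 at *
    field_simp at hlim
    exact hlim
  · have r1 := rising_ne_zero hge (n + 1)
    have r2 := rising_ne_zero hf (n + 1)
    rw [div_mul_eq_mul_div, div_eq_iff (mul_ne_zero r1 r2)]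
    linear_combination (-((n + 1 : ℕ) : ℂ)) * hkey (n + 1)
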